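/- Let $G$ be a finite group of order $r\ge 3$, let $d\ge 0$, and let $\rho\colon G\to O(d)$ be an orthogonal representation that contains no trivial subrepresentation (no nonzero subrepresentation on which $G$ acts trivially); write $g\cdot u=\rho(g)u$ for $u\in\mathbb R^d$. For $N\ge 0$ let $\Delta_{N-1}=\{t\in\mathbb R^N : t_j\ge 0 \text{ for all } j,\ \sum_{j=1}^N t_j=1\}$, with vertices $v_1,\dots,v_N$; the support of $t\in\Delta_{N-1}$ is $\{j : t_j\neq 0\}$. A map $f\colon\Delta_{N-1}\to\mathbb R^d$ is affine if $f(t)=\sum_{j=1}^N t_j f(v_j)$ for all $t\in\Delta_{N-1}$. An orbit partition for $f$ consists of points $x_g\in\Delta_{N-1}$ $(g\in G)$ with pairwise disjoint supports and points $a,u\in\mathbb R^d$ such that $$f(x_g)=a+g\cdot u\qquad\text{for all } g\in G.$$ (i) If $N=(r-2)(d+1)+2$, then every affine map $f\colon\Delta_{N-1}\to\mathbb R^d$ has an orbit partition. (ii) If $N<(r-2)(d+1)+2$, then generic affine maps $f\colon\Delta_{N-1}\to\mathbb R^d$ have no orbit partition; that is, the set of all $N$-tuples $(p_1,\dots,p_N)\in(\mathbb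 R^d)^N$ for which the affine map $f$ with $f(v_j)=p_j$ for all $j$ has no orbit partition is open, dense, and of full Lebesgue measure in $(\mathbb R^d)^N$. -/

import Mathlib

open MeasureTheory

/-- The orthogonal representation `ρ : G → O(d)`, viewed as a linear action of `G` on Euclidean
space `ℝᵈ`: the vector `orthRep ρ g u` is `g · u`. -/
noncomputable def orthRep {G : Type*} [Group G] {d : ℕ}
    (ρ : G →* Matrix.orthogonalGroup (Fin d) ℝ) :
    Representation ℝ G (EuclideanSpace ℝ (Fin d)) where
  toFun g := Matrix.toEuclideanLin (ρ g : Matrix (Fin d) (Fin d) ℝ)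
  map_one' := by
    ext; simp
  map_mul' g h := by
    ext; simp

/-- A representation contains a trivial subrepresentation if it has a nonzero subrepresentation
on which the group acts trivially. -/
def ContainsTrivialSubrep {G V : Type*} [Group G] [AddCommGroup V] [Module ℝ V]
    (τ : Representation ℝ G V) : Prop :=
  ∃ σ : Subrepresentation τ, σ ≠ ⊥ ∧ σ.toRepresentation.IsTrivial

/-- A map on the simplex `Δ_{N-1}` (realized as the standard simplex in `ℝᴺ`) is affine if it sends
each convex sum of the vertices to the corresponding convex sum of their images. -/
def IsAffineOnSimplex {N : ℕ} {V : Type*} [AddCommGroup V] [Module ℝ V]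
    (f : stdSimplex ℝ (Fin N) → V) : Prop :=
  ∀ x : stdSimplex ℝ (Fin N), f x = ∑ j, x j • f (stdSimplex.vertex j)

/-- The affine map on the simplex `Δ_{N-1}` that takes the prescribed values at the vertices. -/
def affineOfVertices {N : ℕ} {V : Type*} [AddCommGroup V] [Module ℝ V]
    (p : Fin N → V) : stdSimplex ℝ (Fin N) → V :=
  fun x => ∑ j, x j • p j

/-- A map on the simplex is affine with vertex images `p` exactly if it is
`affineOfVertices p`. -/
theorem isAffineOnSimplex_and_vertices_iff {N : ℕ} {V : Type*} [AddCommGroup V] [Module ℝ V]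
    (f : stdSimplex ℝ (Fin N) → V) (p : Fin N → V) :
    (IsAffineOnSimplex f ∧ ∀ j, f (stdSimplex.vertex j) = p j) ↔ f = affineOfVertices p := by
  have hv : ∀ j, affineOfVertices p (stdSimplex.vertex j) = p j := by
    intro j
    simp [affineOfVertices, Pi.single_apply]
  constructor
  · rintro ⟨hf, hp⟩
    funext x
    simp only [affineOfVertices, hf x, hp]
  · rintro rfl
    refine ⟨fun x => ?_, hv⟩
    simp only [hv]
    rfl

/-- A property holds for generic affine maps `Δ_{N-1} → ℝᵈ` if the set of `N`-tuples of points in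
`ℝᵈ` whose associated affine map has the property is open, dense and of full Lebesgue measure in
`(ℝᵈ)ᴺ`. -/
def HoldsForGenericAffineMaps (N d : ℕ)
    (P : (stdSimplex ℝ (Fin N) → EuclideanSpace ℝ (Fin d)) → Prop) : Prop :=
  IsOpen {p : Fin N → EuclideanSpace ℝ (Fin d) | P (affineOfVertices p)} ∧
  Dense {p : Fin N → EuclideanSpace ℝ (Fin d) | P (affineOfVertices p)} ∧
  ∀ᵐ p : Fin N → EuclideanSpace ℝ (Fin d), P (affineOfVertices p)

/-- There are points `x_g` of the simplex, indexed by `g ∈ G` and with pairwise disjoint supports,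
and points `a, u ∈ ℝᵈ`, such that `f (x_g) = a + g · u` for all `g`. -/
def HasOrbitPartition {G : Type*} [Group G] {N d : ℕ}
    (ρ : G →* Matrix.orthogonalGroup (Fin d) ℝ)
    (f : stdSimplex ℝ (Fin N) → EuclideanSpace ℝ (Fin d)) : Prop :=
  ∃ x : G → stdSimplex ℝ (Fin N),
    (∀ g h, g ≠ h → Disjoint (Function.support (x g)) (Function.support (x h))) ∧
    ∃ a u : EuclideanSpace ℝ (Fin d), ∀ g, f (x g) = a + orthRep ρ g u

/-! (i) is Sarkaria's tensor trick. In the space of families `G → ℝᵈ × ℝ`, let `L` consist of the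
families `(a + g · u, s)`. Without a trivial subrepresentation `dim L = 2d + 1`, so the quotient by
`L` has dimension `N - 1`. Each vertex image `p` gives a colour class: `(p, 1)` placed in slot `g`,
modulo `L`. The class sums to a constant family, which lies in `L`, so its hull contains `0`.
Colourful Carathéodory (`exists_colorful_weights`) picks one slot per vertex, with weights; this is
the partition, up to scaling by `r`.

(ii) is a dimension count. In each part, solve for one point of nonzero weight: the bad
configurations lie in countably many `C¹` images of spaces of dimension less than `N d`, so they are
null. Compactness of the simplex makes them closed. -/

/-! ### Colourful Carathéodory -/

/-- A point of minimal norm in a convex set has inner product at least its squared norm with every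
point of the set. -/
theorem norm_sq_le_inner_of_norm_le {E : Type*} [NormedAddCommGroup E] [InnerProductSpace ℝ E]
    {C : Set E} (hC : Convex ℝ C) {z : E} (hz : z ∈ C) (hmin : ∀ w ∈ C, ‖z‖ ≤ ‖w‖)
    {w : E} (hw : w ∈ C) : ‖z‖ ^ 2 ≤ inner ℝ z w := by
  have : Nonempty C := ⟨⟨z, hz⟩⟩
  have h : ‖(0 : E) - z‖ = ⨅ w : C, ‖(0 : E) - w‖ := by
    simp only [zero_sub, norm_neg]
    refine le_antisymm (le_ciInf fun w => hmin w w.2) ?_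
    exact ciInf_le (f := fun w : C => ‖(w : E)‖) ⟨0, by rintro _ ⟨w, rfl⟩; exact norm_nonneg _⟩ ⟨z, hz⟩
  have h1 := (norm_eq_iInf_iff_real_inner_le_zero hC hz).1 h w hw
  rw [zero_sub, inner_neg_left, inner_sub_right, real_inner_self_eq_norm_sq] at h1
  linarith

/-- A convex combination of more than `finrank ℝ E` vectors lying in an affine hyperplane
avoiding the origin can be rewritten so that one of the weights vanishes. -/
theorem exists_weights_with_zero {E ι : Type*} [NormedAddCommGroup E] [InnerProductSpace ℝ E]
    [FiniteDimensional ℝ E] [Fintype ι] (hcard : Module.finrank ℝ E < Fintype.card ι)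
    {y : ι → E} {z : E} {b : ℝ} (hb : b ≠ 0) {t : ι → ℝ} (ht0 : ∀ i, 0 ≤ t i)
    (ht1 : ∑ i, t i = 1) (hy : ∀ i, 0 < t i → inner ℝ z (y i) = b) :
    ∃ s : ι → ℝ, (∀ i, 0 ≤ s i) ∧ ∑ i, s i = 1 ∧ ∑ i, s i • y i = ∑ i, t i • y i ∧
      ∃ i, s i = 0 := by
  by_cases hpos : ∃ i, t i = 0
  · exact ⟨t, ht0, ht1, rfl, hpos⟩
  push Not at hpos
  have htpos : ∀ i, 0 < t i := fun i => lt_of_le_of_ne (ht0 i) (hpos i).symm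
  have hdep : ¬ LinearIndependent ℝ y := fun h => hcard.not_ge h.fintype_card_le_finrank
  obtain ⟨α, hα, i₀, hi₀⟩ := Fintype.not_linearIndependent_iff.1 hdep
  -- Pairing the dependence with `z` shows that moving along `α` preserves the total weight.
  have hsum : ∑ i, α i = 0 := by
    have h : inner ℝ z (∑ i, α i • y i) = b * ∑ i, α i := by
      rw [inner_sum, Finset.mul_sum]
      exact Finset.sum_congr rfl fun i _ => by
        rw [inner_smul_right, hy i (htpos i), mul_comm]
    rw [hα, inner_zero_right] at h
    exact (mul_eq_zero.1 h.symm).resolve_left hb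
  have hex : ∃ i, 0 < α i := by
    by_contra! h
    exact hi₀ ((Finset.sum_eq_zero_iff_of_nonpos fun i _ => h i).1 hsum i₀ (Finset.mem_univ _))
  -- The minimal ratio is the longest step that keeps all weights nonnegative.
  obtain ⟨j, hj, hjmin⟩ := (Finset.univ.filter fun i => 0 < α i).exists_min_image
    (fun i => t i / α i) (by obtain ⟨i, hi⟩ := hex; exact ⟨i, by simpa using hi⟩)
  have hαj : 0 < α j := by simpa using hj
  refine ⟨fun i => t i - t j / α j * α i, fun i => ?_, ?_, ?_, j, ?_⟩
  · rw [sub_nonneg]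
    rcases le_or_gt (α i) 0 with hi | hi
    · exact (mul_nonpos_of_nonneg_of_nonpos (by have := htpos j; positivity) hi).trans (ht0 i)
    · rw [← le_div_iff₀ hi]
      exact hjmin i (by simpa using hi)
  · rw [Finset.sum_sub_distrib, ← Finset.mul_sum, hsum, ht1]; simp
  · simp only [sub_smul, Finset.sum_sub_distrib, mul_smul, ← Finset.smul_sum, hα]; simp
  · field_simp; simp

/-- A point of the convex hull of a finite family is a convex combination of the family. -/
theorem exists_weights_of_mem_convexHull_range {E ι : Type*} [AddCommGroup E] [Module ℝ E]
    [Fintype ι] {y : ι → E} {z : E} (hz : z ∈ convexHull ℝ (Set.range y)) :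
    ∃ t : ι → ℝ, (∀ i, 0 ≤ t i) ∧ ∑ i, t i = 1 ∧ ∑ i, t i • y i = z := by
  classical
  have h := (Fintype.linearCombination ℝ y).image_convexHull
    (Set.range fun i => (Pi.single i 1 : ι → ℝ))
  rw [convexHull_rangle_single_eq_stdSimplex, ← Set.range_comp] at h
  have hy : (Fintype.linearCombination ℝ y : (ι → ℝ) → E) ∘ (fun i => (Pi.single i 1 : ι → ℝ))
      = y := by
    ext i; simp
  rw [hy] at h
  obtain ⟨t, ⟨ht0, ht1⟩, rfl⟩ := h.symm ▸ hz
  exact ⟨t, ht0, ht1, by simp [Fintype.linearCombination_apply]⟩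

/-- The colourful Carathéodory theorem in an inner product space. -/
theorem exists_colorful_zero_mem_of_inner {E ι κ : Type*} [NormedAddCommGroup E]
    [InnerProductSpace ℝ E] [FiniteDimensional ℝ E] [Fintype ι] [Finite κ]
    (hcard : Module.finrank ℝ E < Fintype.card ι) (M : ι → κ → E)
    (hM : ∀ i, (0 : E) ∈ convexHull ℝ (Set.range (M i))) :
    ∃ c : ι → κ, (0 : E) ∈ convexHull ℝ (Set.range fun i => M i (c i)) := by
  classical
  have : Nonempty ι := Fintype.card_pos_iff.1 (by omega)
  have hne : ∀ i, ∃ _ : κ, True := fun i => by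
    obtain ⟨_, k, -⟩ := convexHull_nonempty_iff.1 ⟨0, hM i⟩
    exact ⟨k, trivial⟩
  choose c₀ _ using hne
  let K : Set E := ⋃ c : ι → κ, convexHull ℝ (Set.range fun i => M i (c i))
  have hK : IsCompact K := isCompact_iUnion fun c => (Set.finite_range _).isCompact_convexHull ℝ
  have hKne : K.Nonempty := by
    obtain ⟨w, hw⟩ : (convexHull ℝ (Set.range fun i => M i (c₀ i))).Nonempty :=
      convexHull_nonempty_iff.2 (Set.range_nonempty _)
    exact ⟨w, Set.mem_iUnion.2 ⟨c₀, hw⟩⟩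
  obtain ⟨z, hzK, hzmin⟩ := hK.exists_isMinOn hKne continuous_norm.continuousOn
  have hin : ∀ c : ι → κ, z ∈ convexHull ℝ (Set.range fun i => M i (c i)) →
      ∀ w ∈ convexHull ℝ (Set.range fun i => M i (c i)), ‖z‖ ^ 2 ≤ inner ℝ z w :=
    fun c hz w hw => norm_sq_le_inner_of_norm_le (convex_convexHull ℝ _) hz
      (fun v hv => hzmin (Set.mem_iUnion.2 ⟨c, hv⟩)) hw
  obtain ⟨c, hzc⟩ := Set.mem_iUnion.1 hzK
  rcases eq_or_ne z 0 with rfl | hz0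
  · exact ⟨c, hzc⟩
  exfalso
  have hzpos : 0 < ‖z‖ ^ 2 := by positivity
  obtain ⟨t, ht0, ht1, htz⟩ := exists_weights_of_mem_convexHull_range hzc
  have hyi : ∀ i, ‖z‖ ^ 2 ≤ inner ℝ z (M i (c i)) := fun i =>
    hin c hzc _ (subset_convexHull ℝ _ ⟨i, rfl⟩)
  -- The nonnegative excesses average to zero, so points of positive weight lie on the supporting
  -- hyperplane at `z`.
  have hsum : ∑ i, t i * (inner ℝ z (M i (c i)) - ‖z‖ ^ 2) = 0 := by
    have h : inner ℝ z (∑ i, t i • M i (c i)) = ∑ i, t i * inner ℝ z (M i (c i)) := by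
      simp only [inner_sum, inner_smul_right]
    rw [htz, real_inner_self_eq_norm_sq] at h
    simp only [mul_sub, Finset.sum_sub_distrib, ← Finset.sum_mul, ht1, ← h]
    ring
  have hy : ∀ i, 0 < t i → inner ℝ z (M i (c i)) = ‖z‖ ^ 2 := fun i hi => by
    have h := (Finset.sum_eq_zero_iff_of_nonneg fun i _ =>
      mul_nonneg (ht0 i) (sub_nonneg.2 (hyi i))).1 hsum i (Finset.mem_univ _)
    exact sub_eq_zero.1 ((mul_eq_zero.1 h).resolve_left hi.ne')
  obtain ⟨s, hs0, hs1, hsz, j, hsj⟩ := exists_weights_with_zero hcard hzpos.ne' ht0 ht1 hy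
  obtain ⟨k, hk⟩ : ∃ k, inner ℝ z (M j k) ≤ 0 := by
    by_contra! h
    have hsub : convexHull ℝ (Set.range (M j)) ⊆ {w | 0 < inner ℝ z w} :=
      convexHull_min (by rintro _ ⟨k, rfl⟩; exact h k)
        (convex_halfSpace_gt (innerₛₗ ℝ z).isLinear 0)
    simpa using hsub (hM j)
  -- Colour `j` has weight zero, so recolouring keeps `z` in the hull but adds a point beyond the
  -- supporting hyperplane.
  let c' := Function.update c j k
  have hzc'' : z ∈ convexHull ℝ (Set.range fun i => M i (c' i)) := by
    rw [← htz, ← hsz]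
    have : ∀ i ∈ Finset.univ, s i • M i (c i) = s i • M i (c' i) := fun i _ => by
      rcases eq_or_ne i j with rfl | hij
      · simp [hsj]
      · simp [c', hij]
    rw [Finset.sum_congr rfl this]
    exact (convex_convexHull ℝ _).sum_mem (fun i _ => hs0 i) hs1
      fun i _ => subset_convexHull ℝ _ ⟨i, rfl⟩
  have h := hin c' hzc'' (M j k) (subset_convexHull ℝ _ ⟨j, by simp [c']⟩)
  linarith

/-- The **colourful Carathéodory theorem**: if `0` lies in the convex hull of each of more than
`finrank ℝ E` colour classes, then it lies in the convex hull of a set with one point from each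
class. -/
theorem exists_colorful_weights {E ι κ : Type*} [AddCommGroup E] [Module ℝ E]
    [FiniteDimensional ℝ E] [Fintype ι] [Finite κ]
    (hcard : Module.finrank ℝ E < Fintype.card ι) (M : ι → κ → E)
    (hM : ∀ i, (0 : E) ∈ convexHull ℝ (Set.range (M i))) :
    ∃ (c : ι → κ) (t : ι → ℝ), (∀ i, 0 ≤ t i) ∧ ∑ i, t i = 1 ∧ ∑ i, t i • M i (c i) = 0 := by
  let e : E ≃ₗ[ℝ] EuclideanSpace ℝ (Fin (Module.finrank ℝ E)) :=
    LinearEquiv.ofFinrankEq _ _ (by simp)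
  obtain ⟨c, hc⟩ := exists_colorful_zero_mem_of_inner (by simpa using hcard)
    (fun i k => e (M i k)) fun i => by
      have h := Set.mem_image_of_mem e.toLinearMap (hM i)
      rw [map_zero, LinearMap.image_convexHull, ← Set.range_comp] at h
      exact h
  obtain ⟨t, ht0, ht1, ht⟩ := exists_weights_of_mem_convexHull_range hc
  refine ⟨c, t, ht0, ht1, e.injective ?_⟩
  simpa using ht

/-! ### Orbit families and existence of partitions -/

/-- A vector fixed by the whole group vanishes if there is no trivial subrepresentation. -/
theorem eq_zero_of_forall_apply_eq {G V : Type*} [Group G] [AddCommGroup V] [Module ℝ V]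
    {τ : Representation ℝ G V} (hτ : ¬ ContainsTrivialSubrep τ) {u : V} (hu : ∀ g, τ g u = u) :
    u = 0 := by
  by_contra hu0
  have hfix : ∀ g, ∀ v ∈ Submodule.span ℝ {u}, τ g v = v := by
    intro g v hv
    obtain ⟨s, rfl⟩ := Submodule.mem_span_singleton.1 hv
    rw [map_smul, hu]
  refine hτ ⟨⟨Submodule.span ℝ {u}, fun g v hv => by rwa [hfix g v hv]⟩, fun h => hu0 ?_, ⟨?_⟩⟩
  · have : u ∈ (⊥ : Subrepresentation τ) := by
      rw [← h]
      exact Submodule.mem_span_singleton_self u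
    exact (Submodule.mem_bot ℝ).1 this
  · intro g
    ext v
    exact hfix g v v.2

/-- The linear map sending `(a, u, s)` to the family `(a + g · u, s)` indexed by the group. -/
def orbitFamily {G V : Type*} [Group G] [AddCommGroup V] [Module ℝ V]
    (τ : Representation ℝ G V) : (V × V × ℝ) →ₗ[ℝ] (G → V × ℝ) :=
  LinearMap.pi fun g =>
    (LinearMap.fst ℝ V (V × ℝ) + (τ g).comp (LinearMap.fst ℝ V ℝ ∘ₗ LinearMap.snd ℝ V (V × ℝ))).prod
      (LinearMap.snd ℝ V ℝ ∘ₗ LinearMap.snd ℝ V (V × ℝ))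

@[simp]
theorem orbitFamily_apply {G V : Type*} [Group G] [AddCommGroup V] [Module ℝ V]
    (τ : Representation ℝ G V) (a u : V) (s : ℝ) (g : G) :
    orbitFamily τ (a, u, s) g = (a + τ g u, s) := rfl

/-- If `a + g · u = 0` for all `g`, comparison with `g = 1` shows that `u` is fixed by `G`. -/
theorem orbitFamily_injective {G V : Type*} [Group G] [AddCommGroup V] [Module ℝ V]
    {τ : Representation ℝ G V} (hτ : ¬ ContainsTrivialSubrep τ) :
    Function.Injective (orbitFamily τ) := by
  rw [← LinearMap.ker_eq_bot, LinearMap.ker_eq_bot']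
  rintro ⟨a, u, s⟩ h
  have hg : ∀ g, a + τ g u = 0 ∧ s = 0 := fun g => by
    simpa using congrFun h g
  have h1 : a + u = 0 := by simpa using (hg 1).1
  have hu : u = 0 := eq_zero_of_forall_apply_eq hτ fun g =>
    add_left_cancel ((hg g).1.trans h1.symm)
  subst hu
  have ha : a = 0 := by simpa using h1
  simp [ha, (hg 1).2]

theorem finrank_quotient_orbitFamily {G V : Type*} [Group G] [Fintype G] [AddCommGroup V]
    [Module ℝ V] [FiniteDimensional ℝ V] {τ : Representation ℝ G V}
    (hτ : ¬ ContainsTrivialSubrep τ) :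
    Module.finrank ℝ ((G → V × ℝ) ⧸ LinearMap.range (orbitFamily τ)) +
      (2 * Module.finrank ℝ V + 1) = Fintype.card G * (Module.finrank ℝ V + 1) := by
  have h := (LinearMap.range (orbitFamily τ)).finrank_quotient_add_finrank
  rw [LinearMap.finrank_range_of_inj (orbitFamily_injective hτ)] at h
  simp only [Module.finrank_prod, Module.finrank_self, Module.finrank_pi_fintype,
    Finset.sum_const, Finset.card_univ, smul_eq_mul] at h
  rw [← h]
  ring

/-- Existence of an orbit partition of points in a representation, in terms of a colouring of the
points by the group and convex weights. -/
theorem exists_orbit_coloring {G V ι : Type*} [Group G] [Fintype G] [DecidableEq G]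
    [AddCommGroup V] [Module ℝ V] [FiniteDimensional ℝ V] [Fintype ι] {τ : Representation ℝ G V}
    (hτ : ¬ ContainsTrivialSubrep τ)
    (hcard : Fintype.card G * (Module.finrank ℝ V + 1) ≤
      Fintype.card ι + 2 * Module.finrank ℝ V) (p : ι → V) :
    ∃ (c : ι → G) (w : ι → ℝ) (a u : V), (∀ i, 0 ≤ w i) ∧
      (∀ g, ∑ i, (if c i = g then w i else 0) = 1) ∧
      ∀ g, ∑ i, (if c i = g then w i else 0) • p i = a + τ g u := by
  have hfin := finrank_quotient_orbitFamily hτ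
  set L := LinearMap.range (orbitFamily τ)
  have hG : (0 : ℝ) < Fintype.card G := by exact_mod_cast Fintype.card_pos
  obtain ⟨c, t, ht0, ht1, ht⟩ := exists_colorful_weights (by omega)
    (fun i g => L.mkQ (Pi.single g (p i, 1))) fun i => by
      have hmem : (∑ g : G, Pi.single g (p i, (1 : ℝ)) : G → V × ℝ) ∈ L := by
        refine ⟨(p i, 0, 1), ?_⟩
        ext g : 1
        simp
      have h0 : ∑ g : G, (Fintype.card G : ℝ)⁻¹ • L.mkQ (Pi.single g (p i, 1)) = 0 := by
        rw [← Finset.smul_sum, ← map_sum, Submodule.mkQ_apply,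
          (Submodule.Quotient.mk_eq_zero L).2 hmem, smul_zero]
      rw [← h0]
      exact (convex_convexHull ℝ _).sum_mem (fun _ _ => by positivity)
        (by simp [hG.ne']) fun g _ => subset_convexHull ℝ _ ⟨g, rfl⟩
  have hL : ∑ i, t i • (Pi.single (c i) (p i, 1) : G → V × ℝ) ∈ L := by
    rw [← Submodule.Quotient.mk_eq_zero L, ← Submodule.mkQ_apply]
    simpa using ht
  obtain ⟨⟨a, u, s⟩, hs⟩ := hL
  have hcoord : ∀ g, ∑ i, (if c i = g then t i else 0) • p i = a + τ g u ∧
      ∑ i, (if c i = g then t i else 0) = s := fun g => by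
    have h := congrFun hs g
    have h2 : ∀ i, (t i • (Pi.single (c i) (p i, 1) : G → V × ℝ)) g =
        ((if c i = g then t i else 0) • p i, if c i = g then t i else 0) := fun i => by
      by_cases hi : c i = g
      · subst hi; simp
      · simp only [Pi.smul_apply, Pi.single_eq_of_ne (Ne.symm hi), if_neg hi, smul_zero, zero_smul]
        rfl
    rw [orbitFamily_apply, Finset.sum_apply, Finset.sum_congr rfl fun i _ => h2 i] at h
    have h3 := congrArg Prod.fst h
    have h4 := congrArg Prod.snd h
    simp only [Prod.fst_sum, Prod.snd_sum] at h3 h4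
    exact ⟨h3.symm, h4.symm⟩
  -- All parts carry the same weight `s` and the total is 1, hence the rescaling by `|G|`.
  have hrs : Fintype.card G * s = 1 := by
    have h : ∑ g, ∑ i, (if c i = g then t i else 0) = 1 := by
      rw [Finset.sum_comm, ← ht1]
      simp
    simpa [(hcoord _).2] using h
  refine ⟨c, fun i => Fintype.card G * t i, (Fintype.card G : ℝ) • a, (Fintype.card G : ℝ) • u,
    fun i => mul_nonneg hG.le (ht0 i), fun g => ?_, fun g => ?_⟩
  · rw [← hrs, ← (hcoord g).2, Finset.mul_sum]
    simp [mul_ite]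
  · rw [map_smul, ← smul_add, ← (hcoord g).1, Finset.smul_sum]
    simp [smul_smul]

theorem hasOrbitPartition_of_isAffineOnSimplex {G : Type*} [Group G] [Finite G] {N d : ℕ}
    {ρ : G →* Matrix.orthogonalGroup (Fin d) ℝ} (hρ : ¬ ContainsTrivialSubrep (orthRep ρ))
    (hN : Nat.card G * (d + 1) ≤ N + 2 * d)
    {f : stdSimplex ℝ (Fin N) → EuclideanSpace ℝ (Fin d)} (hf : IsAffineOnSimplex f) :
    HasOrbitPartition ρ f := by
  classical
  have := Fintype.ofFinite G
  obtain ⟨c, w, a, u, hw0, hw1, hw⟩ := exists_orbit_coloring (ι := Fin N) hρ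
    (by simpa using hN) fun j => f (stdSimplex.vertex j)
  refine ⟨fun g => ⟨fun i => if c i = g then w i else 0, fun i => ?_, hw1 g⟩, fun g h hgh => ?_,
    a, u, fun g => ?_⟩
  · dsimp only
    split_ifs
    exacts [hw0 i, le_rfl]
  · rw [Set.disjoint_left]
    intro i hi hi'
    have hg : c i = g := by
      by_contra hne
      exact hi (if_neg hne)
    have hh : c i = h := by
      by_contra hne
      exact hi' (if_neg hne)
    exact hgh (hg.symm.trans hh)
  · rw [hf, ← hw g]
    rfl

/-! ### Closedness and nullity of the bad configurations -/

/-- Configurations with an orbit partition form a closed set. -/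
theorem isClosed_setOf_hasOrbitPartition {G : Type*} [Group G] [Finite G] {d : ℕ}
    (ρ : G →* Matrix.orthogonalGroup (Fin d) ℝ) (N : ℕ) :
    IsClosed {p : Fin N → EuclideanSpace ℝ (Fin d) | HasOrbitPartition ρ (affineOfVertices p)} := by
  let V := EuclideanSpace ℝ (Fin d)
  let Φ : (V × V) →ₗ[ℝ] (G → V) :=
    LinearMap.pi fun g => LinearMap.fst ℝ V V + (orthRep ρ g).comp (LinearMap.snd ℝ V V)
  have := Fintype.ofFinite G
  -- Disjointness becomes a closed condition as vanishing products. Membership in a subspace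
  -- eliminates `a` and `u`, so only the compact factor is projected away.
  let S : Set ((G → stdSimplex ℝ (Fin N)) × (Fin N → V)) :=
    {q | (∀ g h, g ≠ h → ∀ i, q.1 g i * q.1 h i = 0) ∧
      (fun g => affineOfVertices q.2 (q.1 g)) ∈ LinearMap.range Φ}
  have hcont : ∀ (g : G) (i : Fin N),
      Continuous fun q : (G → stdSimplex ℝ (Fin N)) × (Fin N → V) => q.1 g i := fun g i =>
    (continuous_apply i).comp
      (continuous_subtype_val.comp ((continuous_apply g).comp continuous_fst))
  have hS : IsClosed S := by
    refine IsClosed.inter ?_ ?_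
    · change IsClosed {q : (G → stdSimplex ℝ (Fin N)) × (Fin N → V) |
        ∀ g h, g ≠ h → ∀ i, q.1 g i * q.1 h i = 0}
      simp only [Set.ofPred_forall]
      exact isClosed_iInter fun g => isClosed_iInter fun h => isClosed_iInter fun _ =>
        isClosed_iInter fun i => isClosed_eq ((hcont g i).mul (hcont h i)) continuous_const
    · refine (Submodule.closed_of_finiteDimensional (LinearMap.range Φ)).preimage
        (continuous_pi fun g => continuous_finsetSum _ fun i _ => (hcont g i).smul ?_)
      exact (continuous_apply i).comp continuous_snd
  convert isClosedMap_snd_of_compactSpace S hS using 1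
  ext p
  constructor
  · rintro ⟨x, hx, a, u, hau⟩
    refine ⟨(x, p), ⟨fun g h hgh i => ?_, (a, u), ?_⟩, rfl⟩
    · by_contra hne
      exact Set.disjoint_left.1 (hx g h hgh) (left_ne_zero_of_mul hne : x g i ≠ 0)
        (right_ne_zero_of_mul hne)
    · ext1 g
      exact (hau g).symm
  · rintro ⟨⟨x, q⟩, ⟨hx, ⟨a, u⟩, hau⟩, rfl⟩
    refine ⟨x, fun g h hgh => Set.disjoint_left.2 fun i hi hi' => ?_, a, u, fun g => ?_⟩
    · exact mul_ne_zero hi hi' (hx g h hgh i)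
    · exact (congrFun hau g).symm

/-- The range of a `C¹` map from a space of smaller dimension is null. -/
theorem addHaar_range_eq_zero_of_finrank_lt {E F : Type*} [NormedAddCommGroup E]
    [NormedSpace ℝ E] [FiniteDimensional ℝ E] [NormedAddCommGroup F] [NormedSpace ℝ F]
    [FiniteDimensional ℝ F] [MeasurableSpace F] [BorelSpace F] (μ : Measure F)
    [μ.IsAddHaarMeasure] {f : E → F} (hf : ContDiff ℝ 1 f)
    (h : Module.finrank ℝ E < Module.finrank ℝ F) : μ (Set.range f) = 0 := by
  refine measure_zero_of_dimH_lt (d := (Module.finrank ℝ F : NNReal)) ?_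
    (hf.dimH_range_le.trans_lt (by exact_mod_cast h))
  rw [NNReal.coe_natCast]
  exact Measure.absolutelyContinuous_isAddHaarMeasure _ _

/-- A parametrization of the configurations of points admitting an orbit partition. The indices
are split as `G ⊕ κ`, with one index for each part and the remaining indices in `κ` distributed
among the parts by `c`. The parameters are the points with indices in `κ`, together with their
weights relative to the selected point of the same part, and the vectors `a` and `u`. -/
def orbitConfiguration {G V ι κ : Type*} [Group G] [DecidableEq G] [AddCommGroup V] [Module ℝ V]
    [Fintype κ] (τ : Representation ℝ G V) (e : G ⊕ κ ≃ ι) (c : κ → G)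
    (q : (κ → ℝ × V) × V × V) (i : ι) : V :=
  Sum.elim
    (fun g => (1 + ∑ k, if c k = g then (q.1 k).1 else 0) • (q.2.1 + τ g q.2.2) -
      ∑ k, if c k = g then (q.1 k).1 • (q.1 k).2 else 0)
    (fun k => (q.1 k).2) (e.symm i)

theorem contDiff_orbitConfiguration {G V ι κ : Type*} [Group G] [DecidableEq G]
    [NormedAddCommGroup V] [NormedSpace ℝ V] [FiniteDimensional ℝ V] [Fintype ι] [Fintype κ]
    (τ : Representation ℝ G V) (e : G ⊕ κ ≃ ι) (c : κ → G) :
    ContDiff ℝ 1 (orbitConfiguration τ e c) := by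
  rw [contDiff_pi]
  intro i
  unfold orbitConfiguration
  rcases e.symm i with g | k
  · have hτ : ContDiff ℝ 1 (τ g) := (τ g).toContinuousLinearMap.contDiff
    refine ContDiff.sub (ContDiff.smul (contDiff_const.add (ContDiff.sum fun k _ => ?_))
      (ContDiff.add (by fun_prop) (hτ.comp (by fun_prop)))) (ContDiff.sum fun k _ => ?_)
    · split_ifs <;> fun_prop
    · split_ifs <;> fun_prop
  · simp only [Sum.elim_inr]
    fun_prop

/-- With `n = |κ|` and `D = dim V`, the claim `n(D + 1) + 2D < (|G| + n)D` rearranges to `hcard`. -/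
theorem finrank_orbitConfiguration_lt {G V ι κ : Type*} [Fintype G] [AddCommGroup V] [Module ℝ V]
    [FiniteDimensional ℝ V] [Fintype ι] [Fintype κ] (e : G ⊕ κ ≃ ι)
    (hcard : Fintype.card ι + 2 * Module.finrank ℝ V <
      Fintype.card G * (Module.finrank ℝ V + 1)) :
    Module.finrank ℝ ((κ → ℝ × V) × V × V) < Module.finrank ℝ (ι → V) := by
  have h : Fintype.card G + Fintype.card κ = Fintype.card ι := by
    rw [← Fintype.card_sum, Fintype.card_congr e]
  simp only [Module.finrank_prod, Module.finrank_pi_fintype, Finset.sum_const, Finset.card_univ,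
    smul_eq_mul, Module.finrank_self]
  rw [← h] at hcard ⊢
  nlinarith

/-- An injection from a finite type extends to an equivalence from a sum with some `Fin n`. -/
theorem exists_sum_fin_equiv_extending {G ι : Type*} [Finite ι] {j : G → ι}
    (hj : Function.Injective j) : ∃ (n : ℕ) (e : G ⊕ Fin n ≃ ι), ∀ g, e (Sum.inl g) = j g := by
  classical
  obtain ⟨n, ⟨f⟩⟩ := Finite.exists_equiv_fin ((Set.range j)ᶜ : Set ι)
  exact ⟨n, ((Equiv.ofInjective j hj).sumCongr f.symm).trans (Equiv.Set.sumCompl _),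
    fun g => rfl⟩

theorem exists_orbitConfiguration_eq {G : Type*} [Group G] [Finite G] [DecidableEq G] {N d : ℕ}
    {ρ : G →* Matrix.orthogonalGroup (Fin d) ℝ} {p : Fin N → EuclideanSpace ℝ (Fin d)}
    (hp : HasOrbitPartition ρ (affineOfVertices p)) :
    ∃ (n : ℕ) (e : G ⊕ Fin n ≃ Fin N) (c : Fin n → G),
      p ∈ Set.range (orbitConfiguration (orthRep ρ) e c) := by
  have := Fintype.ofFinite G
  obtain ⟨x, hx, a, u, hau⟩ := hp
  have hdisj : ∀ {g h : G} {i : Fin N}, x g i ≠ 0 → x h i ≠ 0 → g = h := by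
    intro g h i hg hh
    by_contra hne
    exact Set.disjoint_left.1 (hx g h hne) hg hh
  have hex : ∀ g, ∃ i, x g i ≠ 0 := fun g => by
    by_contra! h
    simpa [h] using stdSimplex.sum_eq_one (x g)
  choose j hj using hex
  obtain ⟨n, e, he⟩ := exists_sum_fin_equiv_extending (j := j)
    fun g h hgh => hdisj (hj g) (hgh ▸ hj h)
  -- An index outside all supports gets the arbitrary colour 1; its relative weight is then 0.
  have hcol : ∀ k : Fin n, ∃ g, ∀ h, x h (e (Sum.inr k)) ≠ 0 → g = h := fun k => by
    by_cases h : ∃ g, x g (e (Sum.inr k)) ≠ 0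
    · exact ⟨h.choose, fun h' hh' => hdisj h.choose_spec hh'⟩
    · push Not at h
      exact ⟨1, fun h' hh' => absurd (h h') hh'⟩
  choose c hc using hcol
  have hsum : ∀ {M : Type} [AddCommGroup M] [Module ℝ M] (g : G) (y : Fin N → M),
      ∑ i, x g i • y i =
        x g (j g) • y (j g) + ∑ k, x g (e (Sum.inr k)) • y (e (Sum.inr k)) := by
    intro M _ _ g y
    rw [← e.sum_comp, Fintype.sum_sum_type]
    congr 1
    simp only [he]
    refine Fintype.sum_eq_single g fun h hne => ?_
    have : x g (j h) = 0 := by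
      by_contra h0
      exact hne (hdisj (hj h) h0)
    rw [this, zero_smul]
  refine ⟨n, e, c, (fun k => (x (c k) (e (Sum.inr k)) / x (c k) (j (c k)), p (e (Sum.inr k))),
    a, u), ?_⟩
  ext1 i
  obtain ⟨g | k, rfl⟩ := e.surjective i
  · simp only [orbitConfiguration, Equiv.symm_apply_apply, Sum.elim_inl]
    rw [he]
    have hα := hj g
    set α := x g (j g)
    have hw : ∀ k, (if c k = g then x (c k) (e (Sum.inr k)) / x (c k) (j (c k)) else 0) =
        α⁻¹ * x g (e (Sum.inr k)) := fun k => by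
      split_ifs with hk
      · rw [hk, div_eq_inv_mul]
      · have : x g (e (Sum.inr k)) = 0 := by
          by_contra h0
          exact hk (hc k g h0)
        rw [this, mul_zero]
    have h1 : α + ∑ k, x g (e (Sum.inr k)) = 1 := by
      have := hsum g fun _ => (1 : ℝ)
      simpa only [smul_eq_mul, mul_one, stdSimplex.sum_eq_one] using this.symm
    have h2 : α • p (j g) + ∑ k, x g (e (Sum.inr k)) • p (e (Sum.inr k)) =
        a + orthRep ρ g u := by
      rw [← hau g]
      exact (hsum g p).symm
    have h3 : ∀ k, (if c k = g then (x (c k) (e (Sum.inr k)) / x (c k) (j (c k))) •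
        p (e (Sum.inr k)) else 0) = α⁻¹ • x g (e (Sum.inr k)) • p (e (Sum.inr k)) := fun k => by
      rw [smul_smul, ← hw k, ite_smul, zero_smul]
    -- Dividing the part's total weight 1 by `α` gives the factor of `a + g · u` in the
    -- parametrization.
    have h4 : 1 + α⁻¹ * ∑ k, x g (e (Sum.inr k)) = α⁻¹ := by
      rw [eq_sub_of_add_eq' h1]
      field_simp
      ring
    simp only [hw, h3, ← Finset.mul_sum, ← Finset.smul_sum]
    rw [h4, ← h2, ← smul_sub, add_sub_cancel_right, inv_smul_smul₀ hα]
  · simp [orbitConfiguration]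

theorem ae_not_hasOrbitPartition {G : Type*} [Group G] [Finite G] {N d : ℕ}
    (ρ : G →* Matrix.orthogonalGroup (Fin d) ℝ) (hN : N + 2 * d < Nat.card G * (d + 1)) :
    ∀ᵐ p : Fin N → EuclideanSpace ℝ (Fin d), ¬ HasOrbitPartition ρ (affineOfVertices p) := by
  classical
  have := Fintype.ofFinite G
  rw [Nat.card_eq_fintype_card] at hN
  rw [ae_iff]
  refine measure_mono_null (t := ⋃ (n : ℕ) (e : G ⊕ Fin n ≃ Fin N) (c : Fin n → G),
    Set.range (orbitConfiguration (orthRep ρ) e c)) ?_ ?_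
  · intro p hp
    simp only [Set.mem_iUnion]
    exact exists_orbitConfiguration_eq (not_not.1 hp)
  · simp only [measure_iUnion_null_iff]
    exact fun n e c => addHaar_range_eq_zero_of_finrank_lt _ (contDiff_orbitConfiguration _ e c)
      (finrank_orbitConfiguration_lt e (by simpa using hN))

theorem theorem2p1 {G : Type*} [Group G] [Finite G] (r : ℕ) (hr : 3 ≤ r) (hG : Nat.card G = r)
    (d : ℕ) (ρ : G →* Matrix.orthogonalGroup (Fin d) ℝ)
    (hρ : ¬ ContainsTrivialSubrep (orthRep ρ)) :
    (∀ f : stdSimplex ℝ (Fin ((r - 2) * (d + 1) + 2)) → EuclideanSpace ℝ (Fin d),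
      IsAffineOnSimplex f → HasOrbitPartition ρ f) ∧
    (∀ N : ℕ, N < (r - 2) * (d + 1) + 2 →
      HoldsForGenericAffineMaps N d (fun f => ¬ HasOrbitPartition ρ f)) := by
  have hcard : (r - 2) * (d + 1) + 2 + 2 * d = Nat.card G * (d + 1) := by
    obtain ⟨m, rfl⟩ := Nat.exists_eq_add_of_le' (show 2 ≤ r by omega)
    rw [hG, Nat.add_sub_cancel]
    ring
  refine ⟨fun f hf => hasOrbitPartition_of_isAffineOnSimplex hρ hcard.ge hf, fun N hN => ?_⟩
  have hae := ae_not_hasOrbitPartition (N := N) ρ (by omega)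
  exact ⟨(isClosed_setOf_hasOrbitPartition ρ N).isOpen_compl, Measure.dense_of_ae hae, hae⟩
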